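/- Let $1\le k\le n$ and let $\mathrm{St}(n,k)=\{X\in\mathbb R^{n\times k}: X^\top X=I_k\}$ carry the Euclidean metric $\langle V,W\rangle=2\operatorname{tr}(V^\top W)$ induced from $\mathbb R^{n\times k}$. Fix $X\in\mathrm{St}(n,k)$, and write $P_X^\perp$ for the orthogonal projection of $\mathbb R^{n\times k}$ onto the normal space $N_X\mathrm{St}(n,k)$. The group $O(n)\times O(k)$ acts on $\mathbb R^{n\times k}$ by $\Phi_{(R,\theta)}(V)=RV\theta^\top$; let $\Phi_X(R,\theta)=RX\theta^\top$, with differential $d_{(I_n,I_k)}\Phi_X(\Omega,\eta)=\Omega X-X\eta$. Let $\mathfrak h\subset\mathfrak g=\mathfrak{so}(n)\times\mathfrak{so}(k)$ be the kernel of this differential (the Lie algebra of the isotropy group of $X$), let $\mathfrak p=\mathfrak h^{\perp}$ with respect to the scalar product $-\operatorname{tr}(\Omega_1\Omega_2)+2\operatorname{tr}(\Psi_1\Psi_2)$ of $(\Omega_1,\Psi_1)$ and $(\Omega_2,\Psi_2)$ on $\mathfrak g$, let $\mathrm{pr}_{\mathfrak p}:\mathfrak g=\mathfrak p\oplus\mathfrak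 h\to\mathfrak p$ be the projection along $\mathfrak h$, and let $L_q$ denote left translation by $q$ on $O(n)\times O(k)$. Let $M,\widehat M$ be submanifolds of a Euclidean vector space with the induced metrics and let $I\subset\mathbb R$ be an interval with more than one point. An extrinsic rolling of $M$ over $\widehat M$ on $I$ is a quadruple $(\beta,\widehat\beta,B,C)$ of smooth curves $\beta:I\to M$, $\widehat\beta:I\to\widehat M$ and linear isometries $B(t):T_{\beta(t)}M\to T_{\widehat\beta(t)}\widehat M$, $C(t):N_{\beta(t)}M\to N_{\widehat\beta(t)}\widehat M$, $t\in I$, such that $\dot{\widehat\beta}(t)=B(t)\dot\beta(t)$ for all $t\in I$; a tangent vector field $Z$ along $\beta$ is parallel in $M$ if and only if $B(t)Z(t)$ is parallel in $\widehat M$ along $\widehat\beta$; and a normal vector field $Z$ along $\beta$ is normal parallel in $M$ if and only if $C(t)Z(t)$ is normal parallel in $\widehat M$ along $\widehat\beta$. (A smooth tangent, respectively normal, field along a curve is parallel, respectively normal parallel, if the tangential, respectively normal, part of its derivative vanishes.) Let $\xi=(\xi_1,\xi_2)\in\mathfrak p$, let $f_\xi(V)=\xi_1V-V\xi_2$ for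 $V\in\mathbb R^{n\times k}$, and put $q(t)=(e^{t\xi_1},e^{t\xi_2})$, $$\beta(t)=d_{(I_n,I_k)}\Phi_X(t\xi)=t(\xi_1X-X\xi_2),\qquad \widehat\beta(t)=\Phi_X(q(t))=e^{t\xi_1}Xe^{-t\xi_2},$$ $$B(t)=d_{q(t)}\Phi_X\circ d_{(I_n,I_k)}L_{q(t)}\circ\exp\bigl(-\tfrac12t\,(\mathrm{pr}_{\mathfrak p}\circ\mathrm{ad}_{\xi})|_{\mathfrak p}\bigr)\circ\bigl(d_{(I_n,I_k)}\Phi_X|_{\mathfrak p}\bigr)^{-1},$$ $$C(t)=\Phi_{q(t)}\circ\exp\bigl(-t\,(P_X^\perp\circ f_\xi)|_{N_X\mathrm{St}(n,k)}\bigr),$$ where $T_{\beta(t)}(T_X\mathrm{St}(n,k))=T_X\mathrm{St}(n,k)$ and $N_{\beta(t)}(T_X\mathrm{St}(n,k))=N_X\mathrm{St}(n,k)$ are the canonical identifications for the linear subspace $T_X\mathrm{St}(n,k)\subset\mathbb R^{n\times k}$. Then, on every such interval $I$, $(\beta,\widehat\beta,B,C)$ is an extrinsic rolling of $T_X\mathrm{St}(n,k)$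 over $\mathrm{St}(n,k)$, and its development curve $\widehat\beta$ is a geodesic of $\mathrm{St}(n,k)$. -/

import Mathlib

open scoped Matrix ContDiff

attribute [local instance] Matrix.frobeniusNormedAddCommGroup Matrix.frobeniusNormedSpace
attribute [local instance 100] LieRing.ofAssociativeRing

namespace StiefelRolling

noncomputable section

/-! ### Submanifolds of a (pseudo-)Euclidean vector space and extrinsic rolling -/

section Submanifolds

variable {V : Type*} [AddCommGroup V] [Module ℝ V]

open Classical in
/-- The orthogonal projection `V → W` with respect to the bilinear form `g`. It exists exactly when
`V` is the direct sum of `W` and its `g`-orthogonal complement. -/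
def orthProj (g : LinearMap.BilinForm ℝ V) (W : Submodule ℝ V) : V →ₗ[ℝ] W :=
  if hW : IsCompl W (g.orthogonal W) then W.projectionOnto (g.orthogonal W) hW else 0

/-- `f` is a linear isometry of `W₁` onto `W₂`, both with the scalar product induced by `g`. -/
def IsLinearIsometry (g : LinearMap.BilinForm ℝ V) {W₁ W₂ : Submodule ℝ V} (f : W₁ →ₗ[ℝ] W₂) :
    Prop :=
  Function.Bijective f ∧ ∀ v w : W₁, g (f v : V) (f w : V) = g (v : V) (w : V)

end Submanifolds

section Rolling

variable {V : Type*} [NormedAddCommGroup V] [NormedSpace ℝ V]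

/-- The tangent space at `x` of a submanifold `M` of the vector space `V`, as a subspace of `V`: it
consists of the velocities of the smooth curves in `M` through `x`. (For a submanifold these already
form a subspace.) -/
def tangentSpace (M : Set V) (x : V) : Submodule ℝ V :=
  Submodule.span ℝ
    {v | ∃ γ : ℝ → V, ContDiff ℝ ∞ γ ∧ (∀ s, γ s ∈ M) ∧ γ 0 = x ∧ deriv γ 0 = v}

/-- The normal space of `M` at `x` with respect to the scalar product `g` of the ambient space. -/
def normalSpace (g : LinearMap.BilinForm ℝ V) (M : Set V) (x : V) : Submodule ℝ V :=
  g.orthogonal (tangentSpace M x)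

/-- `γ` is a smooth curve in `M`, defined on the interval `I`. -/
def IsCurve (M : Set V) (I : Set ℝ) (γ : ℝ → V) : Prop :=
  ContDiffOn ℝ ∞ γ I ∧ ∀ t ∈ I, γ t ∈ M

/-- The covariant derivative along `γ : I → M` of a tangent vector field `Z`, for the Levi-Civita
connection of the metric that `g` induces on `M`: the tangential part of the derivative of `Z`. -/
def covDeriv (g : LinearMap.BilinForm ℝ V) (M : Set V) (I : Set ℝ) (γ Z : ℝ → V) (t : ℝ) :
    tangentSpace M (γ t) :=
  orthProj g (tangentSpace M (γ t)) (derivWithin Z I t)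

/-- The covariant derivative along `γ : I → M` of a normal vector field `Z`, for the normal
connection: the normal part of the derivative of `Z`. -/
def normalCovDeriv (g : LinearMap.BilinForm ℝ V) (M : Set V) (I : Set ℝ) (γ Z : ℝ → V) (t : ℝ) :
    normalSpace g M (γ t) :=
  orthProj g (normalSpace g M (γ t)) (derivWithin Z I t)

/-- The tangent vector field `Z` is a (smooth) parallel vector field along `γ : I → M`. -/
def IsParallel (g : LinearMap.BilinForm ℝ V) (M : Set V) (I : Set ℝ) (γ : ℝ → V)
    (Z : ∀ t, tangentSpace M (γ t)) : Prop :=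
  ContDiffOn ℝ ∞ (fun t => (Z t : V)) I ∧
    ∀ t ∈ I, covDeriv g M I γ (fun s => (Z s : V)) t = 0

/-- The normal vector field `Z` is a (smooth) normal parallel vector field along `γ : I → M`. -/
def IsNormalParallel (g : LinearMap.BilinForm ℝ V) (M : Set V) (I : Set ℝ) (γ : ℝ → V)
    (Z : ∀ t, normalSpace g M (γ t)) : Prop :=
  ContDiffOn ℝ ∞ (fun t => (Z t : V)) I ∧
    ∀ t ∈ I, normalCovDeriv g M I γ (fun s => (Z s : V)) t = 0

/-- `γ : I → M` is a geodesic of `M` with the metric induced by `g`: a smooth curve whose velocity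
has zero covariant derivative along it. -/
def IsGeodesic (g : LinearMap.BilinForm ℝ V) (M : Set V) (I : Set ℝ) (γ : ℝ → V) : Prop :=
  IsCurve M I γ ∧ ∀ t ∈ I, covDeriv g M I γ (fun s => derivWithin γ I s) t = 0

/-- The quadruple `(α, α', A, C)` is an extrinsic rolling of `M` over `M'` on the interval `I`,
where `M` and `M'` are submanifolds of `V` with the metrics induced by `g`. -/
structure IsExtrinsicRolling (g : LinearMap.BilinForm ℝ V) (M M' : Set V) (I : Set ℝ)
    (α α' : ℝ → V) (A : ∀ t, tangentSpace M (α t) →ₗ[ℝ] tangentSpace M' (α' t))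
    (C : ∀ t, normalSpace g M (α t) →ₗ[ℝ] normalSpace g M' (α' t)) : Prop where
  rolling_curve : IsCurve M I α
  development_curve : IsCurve M' I α'
  isometry_tangent : ∀ t ∈ I, IsLinearIsometry g (A t)
  isometry_normal : ∀ t ∈ I, IsLinearIsometry g (C t)
  no_slip : ∀ t ∈ I, ∃ v : tangentSpace M (α t),
    (v : V) = derivWithin α I t ∧ derivWithin α' I t = (A t v : V)
  no_twist_tangent : ∀ X : (∀ t, tangentSpace M (α t)),
    IsParallel g M' I α' (fun t => A t (X t)) ↔ IsParallel g M I α X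
  no_twist_normal : ∀ Z : (∀ t, normalSpace g M (α t)),
    IsNormalParallel g M' I α' (fun t => C t (Z t)) ↔ IsNormalParallel g M I α Z

/-- The exponential of an endomorphism of a finite-dimensional real vector space. -/
def endExp {W : Type*} [NormedAddCommGroup W] [NormedSpace ℝ W] [FiniteDimensional ℝ W]
    (A : W →ₗ[ℝ] W) : W →ₗ[ℝ] W :=
  (NormedSpace.exp (LinearMap.toContinuousLinearMap A) : W →L[ℝ] W)

/-- The tangent space of a linear subspace at one of its points is the subspace itself. -/
lemma tangentSpace_submodule (W : Submodule ℝ V) {w : V} (hw : w ∈ W) [FiniteDimensional ℝ V] :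
    tangentSpace (W : Set V) w = W := by
  refine le_antisymm (Submodule.span_le.2 ?_) fun v hv => Submodule.subset_span ?_
  · rintro v ⟨γ, hγ, hM, -, rfl⟩
    have hd : HasDerivAt γ (deriv γ 0) 0 :=
      ((hγ.differentiable (by simp)) 0).hasDerivAt
    have := hasDerivAt_iff_tendsto_slope_zero.1 hd
    refine (Submodule.closed_of_finiteDimensional W).mem_of_tendsto this
      (Filter.Eventually.of_forall fun t => ?_)
    exact W.smul_mem _ (W.sub_mem (hM _) (hM _))
  · refine ⟨fun s => w + s • v, by fun_prop, fun s => W.add_mem hw (W.smul_mem _ hv), by simp, ?_⟩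
    have : HasDerivAt (fun s : ℝ => w + s • v) ((1 : ℝ) • v) 0 :=
      ((hasDerivAt_id (0 : ℝ)).smul_const v).const_add w
    simpa using this.deriv

end Rolling

/-! ### The Stiefel manifold -/

variable {n k : ℕ}

/-- The Euclidean metric `⟨V, W⟩ = 2 tr(Vᵀ W)` on `ℝ^{n×k}`. -/
def euclideanMetric (n k : ℕ) : LinearMap.BilinForm ℝ (Matrix (Fin n) (Fin k) ℝ) :=
  LinearMap.mk₂ ℝ (fun V W => 2 * (Vᵀ * W).trace)
    (fun V V' W => by simp [Matrix.add_mul, mul_add])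
    (fun c V W => by simp; ring)
    (fun V W W' => by simp [Matrix.mul_add, mul_add])
    (fun c V W => by simp; ring)

/-- The Stiefel manifold `St(n,k)`. -/
def stiefel (n k : ℕ) : Set (Matrix (Fin n) (Fin k) ℝ) := {X | Xᵀ * X = 1}

/-- The group `G = O(n) × O(k)`. -/
abbrev OProd (n k : ℕ) : Type :=
  Matrix.orthogonalGroup (Fin n) ℝ × Matrix.orthogonalGroup (Fin k) ℝ

/-- The Lie algebra `𝔤 = 𝔰𝔬(n) × 𝔰𝔬(k)` of `G`, as a space of pairs of matrices. -/
def soProd (n k : ℕ) : Submodule ℝ (Matrix (Fin n) (Fin n) ℝ × Matrix (Fin k) (Fin k) ℝ) :=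
  (LieAlgebra.Orthogonal.so (Fin n) ℝ).toSubmodule.prod
    (LieAlgebra.Orthogonal.so (Fin k) ℝ).toSubmodule

lemma mem_soProd {z : Matrix (Fin n) (Fin n) ℝ × Matrix (Fin k) (Fin k) ℝ} :
    z ∈ soProd n k ↔ z.1ᵀ = -z.1 ∧ z.2ᵀ = -z.2 := by
  simp only [soProd, Submodule.mem_prod, LieSubalgebra.mem_toSubmodule,
    LieAlgebra.Orthogonal.mem_so]

/-- `ad_ξ : 𝔤 → 𝔤`, `ζ ↦ [ξ, ζ]`, where the bracket of `𝔤` is the componentwise commutator. -/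
def adSo (ξ : soProd n k) : soProd n k →ₗ[ℝ] soProd n k where
  toFun ζ := ⟨(⁅ξ.1.1, ζ.1.1⁆, ⁅ξ.1.2, ζ.1.2⁆),
    (LieAlgebra.Orthogonal.so (Fin n) ℝ).lie_mem ξ.2.1 ζ.2.1,
    (LieAlgebra.Orthogonal.so (Fin k) ℝ).lie_mem ξ.2.2 ζ.2.2⟩
  map_add' ζ ζ' := by ext : 2 <;> simp
  map_smul' c ζ := by ext : 2 <;> simp

/-- The exponential map `exp(ξ) = (e^{ξ₁}, e^{ξ₂})` of `G`. -/
def expG (ξ : soProd n k) : OProd n k :=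
  (⟨NormedSpace.exp ξ.1.1, by
      rw [Matrix.mem_orthogonalGroup_iff, ← Matrix.exp_transpose, (mem_soProd.1 ξ.2).1,
        Matrix.exp_neg]
      exact Matrix.mul_nonsing_inv _
        ((Matrix.isUnit_iff_isUnit_det _).1 (Matrix.isUnit_exp _))⟩,
    ⟨NormedSpace.exp ξ.1.2, by
      rw [Matrix.mem_orthogonalGroup_iff, ← Matrix.exp_transpose, (mem_soProd.1 ξ.2).2,
        Matrix.exp_neg]
      exact Matrix.mul_nonsing_inv _
        ((Matrix.isUnit_iff_isUnit_det _).1 (Matrix.isUnit_exp _))⟩)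

/-- The linear action `Φ_{(R, θ)}(V) = R V θᵀ` of `G` on `ℝ^{n×k}`. -/
def Phi (q : OProd n k) : Matrix (Fin n) (Fin k) ℝ →ₗ[ℝ] Matrix (Fin n) (Fin k) ℝ where
  toFun V := q.1.1 * V * q.2.1ᵀ
  map_add' V W := by simp [Matrix.mul_add, Matrix.add_mul]
  map_smul' c V := by simp

/-- The linear map `f_{(ξ₁, ξ₂)}(V) = ξ₁ V - V ξ₂` on `ℝ^{n×k}`. -/
def fMap (ξ : soProd n k) : Matrix (Fin n) (Fin k) ℝ →ₗ[ℝ] Matrix (Fin n) (Fin k) ℝ where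
  toFun V := ξ.1.1 * V - V * ξ.1.2
  map_add' V W := by simp only [Matrix.mul_add, Matrix.add_mul]; abel
  map_smul' c V := by simp [smul_sub]

/-- The differential at `(I_n, I_k)` of the left translation `L_q` of `G`, i.e.
`(Ω, η) ↦ (R Ω, θ η)` for `q = (R, θ)`. -/
def dLeft (q : OProd n k) :
    soProd n k →ₗ[ℝ] Matrix (Fin n) (Fin n) ℝ × Matrix (Fin k) (Fin k) ℝ where
  toFun ζ := (q.1.1 * ζ.1.1, q.2.1 * ζ.1.2)
  map_add' ζ ζ' := by simp [Matrix.mul_add]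
  map_smul' c ζ := by simp

/-- The differential at `q = (R, θ)` of the orbit map `ι_X ∘ π : (R, θ) ↦ R X θᵀ`, i.e.
`(U, W) ↦ U X θᵀ + R X Wᵀ`. -/
def dOrbit (X : Matrix (Fin n) (Fin k) ℝ) (q : OProd n k) :
    Matrix (Fin n) (Fin n) ℝ × Matrix (Fin k) (Fin k) ℝ →ₗ[ℝ] Matrix (Fin n) (Fin k) ℝ where
  toFun z := z.1 * X * q.2.1ᵀ + q.1.1 * X * z.2ᵀ
  map_add' z z' := by simp [Matrix.mul_add, Matrix.add_mul]; abel
  map_smul' c z := by simp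

/-- The differential at `(I_n, I_k)` of `ι_X ∘ π`, on the Lie algebra `𝔤`. -/
def dOrbitOne (X : Matrix (Fin n) (Fin k) ℝ) : soProd n k →ₗ[ℝ] Matrix (Fin n) (Fin k) ℝ :=
  dOrbit X 1 ∘ₗ (soProd n k).subtype

lemma dOrbitOne_apply (X : Matrix (Fin n) (Fin k) ℝ) (ζ : soProd n k) :
    dOrbitOne X ζ = ζ.1.1 * X - X * ζ.1.2 := by
  have h := (mem_soProd.1 ζ.2).2
  simp [dOrbitOne, dOrbit, h, sub_eq_add_neg]

/-- The scalar product `-tr(Ω₁ Ω₂) - a⁻¹ tr(Ψ₁ Ψ₂)` on `𝔤`, for the parameter `a ≠ 0`. -/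
def alphaForm (n k : ℕ) (a : ℝ) : LinearMap.BilinForm ℝ (soProd n k) :=
  LinearMap.mk₂ ℝ (fun z w => -(z.1.1 * w.1.1).trace - 1 / a * (z.1.2 * w.1.2).trace)
    (fun z z' w => by simp [Matrix.add_mul]; ring)
    (fun c z w => by simp; ring)
    (fun z w w' => by simp [Matrix.mul_add]; ring)
    (fun c z w => by simp; ring)

/-- The Lie algebra `𝔥` of the isotropy group of `X`. -/
def hSub (X : Matrix (Fin n) (Fin k) ℝ) : Submodule ℝ (soProd n k) :=
  LinearMap.ker (dOrbitOne X)

/-- The orthogonal complement `𝔭 = 𝔥^⊥` for the parameter `-1/2`, which corresponds to the Euclidean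
metric on the Stiefel manifold. -/
def pSub (X : Matrix (Fin n) (Fin k) ℝ) : Submodule ℝ (soProd n k) :=
  (alphaForm n k (-1 / 2)).orthogonal (hSub X)

lemma mem_hSub {X : Matrix (Fin n) (Fin k) ℝ} {ζ : soProd n k} :
    ζ ∈ hSub X ↔ ζ.1.1 * X = X * ζ.1.2 := by
  rw [hSub, LinearMap.mem_ker, dOrbitOne_apply, sub_eq_zero]

lemma mem_pSub {X : Matrix (Fin n) (Fin k) ℝ} {ζ : soProd n k} :
    ζ ∈ pSub X ↔ ∀ w ∈ hSub X, -(w.1.1 * ζ.1.1).trace + 2 * (w.1.2 * ζ.1.2).trace = 0 := by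
  rw [pSub, LinearMap.BilinForm.mem_orthogonal_iff]
  refine forall₂_congr fun w _ => ?_
  simp only [alphaForm, LinearMap.mk₂_apply]
  rw [show (1 : ℝ) / (-1 / 2) = -2 by norm_num]
  constructor <;> intro h <;> linarith

/-- The element `(V Xᵀ - X Vᵀ, Xᵀ V)` of `𝔤`, for `V` with `Xᵀ V` skew-symmetric. -/
def liftElt (X V : Matrix (Fin n) (Fin k) ℝ) (hV : Xᵀ * V + Vᵀ * X = 0) : soProd n k :=
  ⟨(V * Xᵀ - X * Vᵀ, Xᵀ * V), mem_soProd.2 ⟨by simp, by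
    simpa using eq_neg_of_add_eq_zero_right hV⟩⟩

lemma dOrbitOne_liftElt {X V : Matrix (Fin n) (Fin k) ℝ} (hX : X ∈ stiefel n k)
    (hV : Xᵀ * V + Vᵀ * X = 0) : dOrbitOne X (liftElt X V hV) = V := by
  have hX : Xᵀ * X = 1 := hX
  have h2 : Vᵀ * X = -(Xᵀ * V) := eq_neg_of_add_eq_zero_right hV
  simp [dOrbitOne_apply, liftElt, Matrix.sub_mul, Matrix.mul_assoc, hX, h2]

lemma liftElt_mem {X V : Matrix (Fin n) (Fin k) ℝ} (hV : Xᵀ * V + Vᵀ * X = 0) :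
    liftElt X V hV ∈ pSub X := by
  refine mem_pSub.2 fun w hw => ?_
  have hw' := mem_hSub.1 hw
  obtain ⟨h1, h2⟩ := mem_soProd.1 w.2
  have hw'' : Xᵀ * w.1.1 = w.1.2 * Xᵀ := by
    have := congrArg Matrix.transpose hw'
    simpa [h1, h2] using this
  have h3 : Vᵀ * X = -(Xᵀ * V) := eq_neg_of_add_eq_zero_right hV
  have e1 : (w.1.1 * (V * Xᵀ)).trace = (w.1.2 * (Xᵀ * V)).trace := by
    rw [← Matrix.mul_assoc, Matrix.trace_mul_comm, ← Matrix.mul_assoc, hw'', Matrix.mul_assoc]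
  have e2 : (w.1.1 * (X * Vᵀ)).trace = -(w.1.2 * (Xᵀ * V)).trace := by
    rw [← Matrix.mul_assoc, hw', Matrix.trace_mul_comm, ← Matrix.mul_assoc, h3, Matrix.neg_mul,
      Matrix.trace_neg, Matrix.trace_mul_comm]
  simp only [liftElt, Matrix.mul_sub, Matrix.trace_sub, e1, e2]
  ring

lemma dOrbitOne_skew {X : Matrix (Fin n) (Fin k) ℝ} (hX : X ∈ stiefel n k) (ζ : soProd n k) :
    Xᵀ * dOrbitOne X ζ + (dOrbitOne X ζ)ᵀ * X = 0 := by
  have hX : Xᵀ * X = 1 := hX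
  obtain ⟨h1, h2⟩ := mem_soProd.1 ζ.2
  simp only [dOrbitOne_apply, Matrix.transpose_sub, Matrix.transpose_mul, h1, h2, Matrix.mul_sub,
    Matrix.sub_mul, Matrix.mul_neg, Matrix.neg_mul]
  rw [← Matrix.mul_assoc Xᵀ X, hX, Matrix.mul_assoc (ζ.1.2) Xᵀ X, hX]
  simp [Matrix.mul_assoc]

lemma disjoint_hSub_pSub {X : Matrix (Fin n) (Fin k) ℝ} (hX : X ∈ stiefel n k) :
    Disjoint (pSub X) (hSub X) := by
  have hX : Xᵀ * X = 1 := hX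
  rw [Submodule.disjoint_def]
  intro r hp hh
  have hr := mem_hSub.1 hh
  obtain ⟨h1, h2⟩ := mem_soProd.1 r.2
  have hp := mem_pSub.1 hp
  have e2 : r.1.2 = 0 := by
    have hmem : (X * r.1.2 * Xᵀ, r.1.2) ∈ soProd n k :=
      mem_soProd.2 ⟨by simp [h2, Matrix.mul_assoc], h2⟩
    have := hp ⟨_, hmem⟩ (mem_hSub.2 (by simp [Matrix.mul_assoc, hX]))
    simp only at this
    have e : (X * r.1.2 * Xᵀ * r.1.1).trace = (r.1.2 * r.1.2).trace := by
      rw [Matrix.mul_assoc, Matrix.trace_mul_comm, Matrix.mul_assoc, ← Matrix.mul_assoc r.1.1, hr,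
        ← Matrix.mul_assoc, ← Matrix.mul_assoc, hX, Matrix.one_mul]
    rw [e] at this
    have h0 : (r.1.2ᵀ * r.1.2).trace = 0 := by
      rw [h2, Matrix.neg_mul, Matrix.trace_neg]; linarith
    have := (Matrix.trace_conjTranspose_mul_self_eq_zero_iff (A := r.1.2)).1
      (by simpa [Matrix.conjTranspose_eq_transpose_of_trivial] using h0)
    exact this
  have e1 : r.1.1 = 0 := by
    have := hp r hh
    rw [e2] at this
    have h0 : (r.1.1ᵀ * r.1.1).trace = 0 := by
      rw [h1, Matrix.neg_mul, Matrix.trace_neg]; simpa using this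
    exact (Matrix.trace_conjTranspose_mul_self_eq_zero_iff (A := r.1.1)).1
      (by simpa [Matrix.conjTranspose_eq_transpose_of_trivial] using h0)
  exact Subtype.ext (Prod.ext e1 e2)

/-- The reductive decomposition `𝔤 = 𝔭 ⊕ 𝔥`. -/
lemma isCompl_pSub_hSub {X : Matrix (Fin n) (Fin k) ℝ} (hX : X ∈ stiefel n k) :
    IsCompl (pSub X) (hSub X) := by
  refine ⟨disjoint_hSub_pSub hX, ?_⟩
  rw [codisjoint_iff, eq_top_iff]
  intro ζ _
  have hV := dOrbitOne_skew hX ζ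
  refine Submodule.mem_sup.2 ⟨liftElt X _ hV, liftElt_mem hV, ζ - liftElt X _ hV, ?_, by abel⟩
  rw [hSub, LinearMap.mem_ker, map_sub, dOrbitOne_liftElt hX hV, sub_self]

lemma Phi_expG_smul (ζ : soProd n k) (t : ℝ) (X : Matrix (Fin n) (Fin k) ℝ) :
    Phi (expG (t • ζ)) X = NormedSpace.exp (t • ζ.1.1) * X * NormedSpace.exp (t • -ζ.1.2) := by
  simp [Phi, expG, ← Matrix.exp_transpose, (mem_soProd.1 ζ.2).2]

lemma Phi_mem {X : Matrix (Fin n) (Fin k) ℝ} (hX : X ∈ stiefel n k) (q : OProd n k) :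
    Phi q X ∈ stiefel n k := by
  have hX : Xᵀ * X = 1 := hX
  have h1 : q.1.1ᵀ * q.1.1 = 1 := (Matrix.mem_orthogonalGroup_iff' _ _).1 q.1.2
  have h2 : q.2.1 * q.2.1ᵀ = 1 := (Matrix.mem_orthogonalGroup_iff _ _).1 q.2.2
  show (q.1.1 * X * q.2.1ᵀ)ᵀ * (q.1.1 * X * q.2.1ᵀ) = 1
  calc (q.1.1 * X * q.2.1ᵀ)ᵀ * (q.1.1 * X * q.2.1ᵀ)
      = q.2.1 * (Xᵀ * ((q.1.1ᵀ * q.1.1) * X)) * q.2.1ᵀ := by simp [Matrix.mul_assoc]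
    _ = 1 := by rw [h1, Matrix.one_mul, hX, Matrix.mul_one, h2]

section Calculus

attribute [local instance] Matrix.frobeniusNormedRing Matrix.frobeniusNormedAlgebra

lemma hasDerivAt_mul {l m p : ℕ} {f : ℝ → Matrix (Fin l) (Fin m) ℝ}
    {g : ℝ → Matrix (Fin m) (Fin p) ℝ} {f' : Matrix (Fin l) (Fin m) ℝ}
    {g' : Matrix (Fin m) (Fin p) ℝ} {t : ℝ} (hf : HasDerivAt f f' t) (hg : HasDerivAt g g' t) :
    HasDerivAt (fun s => f s * g s) (f t * g' + f' * g t) t := by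
  have h := (LinearMap.mk₂ ℝ
      (fun (A : Matrix (Fin l) (Fin m) ℝ) (B : Matrix (Fin m) (Fin p) ℝ) => A * B)
      Matrix.add_mul (fun c A B => Matrix.smul_mul c A B) Matrix.mul_add
      (fun c A B => Matrix.mul_smul A c B)).toContinuousBilinearMap.isBoundedBilinearMap.hasFDerivAt
        (f t, g t)
  exact h.comp_hasDerivAt t (hf.prodMk hg)

lemma contDiff_mul {l m p : ℕ} {f : ℝ → Matrix (Fin l) (Fin m) ℝ}
    {g : ℝ → Matrix (Fin m) (Fin p) ℝ} (hf : ContDiff ℝ ∞ f) (hg : ContDiff ℝ ∞ g) :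
    ContDiff ℝ ∞ (fun s => f s * g s) :=
  (LinearMap.mk₂ ℝ (fun (A : Matrix (Fin l) (Fin m) ℝ) (B : Matrix (Fin m) (Fin p) ℝ) => A * B)
      Matrix.add_mul (fun c A B => Matrix.smul_mul c A B) Matrix.mul_add
      (fun c A B => Matrix.mul_smul A c B)).toContinuousBilinearMap.isBoundedBilinearMap.contDiff.comp
    (hf.prodMk hg)

lemma hasDerivAt_transpose {f : ℝ → Matrix (Fin n) (Fin k) ℝ} {f' : Matrix (Fin n) (Fin k) ℝ}
    {t : ℝ} (hf : HasDerivAt f f' t) : HasDerivAt (fun s => (f s)ᵀ) f'ᵀ t :=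
  ((Matrix.transposeLinearEquiv (Fin n) (Fin k) ℝ ℝ).toLinearMap.toContinuousLinearMap
    ).hasFDerivAt.comp_hasDerivAt t hf

lemma hasDerivAt_exp (A : Matrix (Fin n) (Fin n) ℝ) :
    HasDerivAt (fun s : ℝ => NormedSpace.exp (s • A)) A 0 := by
  have h := hasDerivAt_exp_smul_const A (0 : ℝ)
  rw [zero_smul, NormedSpace.exp_zero, one_mul] at h
  exact h

lemma contDiff_exp (A : Matrix (Fin n) (Fin n) ℝ) :
    ContDiff ℝ ∞ (fun s : ℝ => NormedSpace.exp (s • A)) := by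
  have h : ContDiff ℝ ∞ (NormedSpace.exp : Matrix (Fin n) (Fin n) ℝ → Matrix (Fin n) (Fin n) ℝ) :=
    contDiff_iff_contDiffAt.2 fun x => (NormedSpace.exp_analytic (𝕂 := ℝ) x).contDiffAt
  exact h.comp (contDiff_id.smul contDiff_const)

end Calculus

/-- The tangent space of the Stiefel manifold is `{V | Xᵀ V + Vᵀ X = 0}`. -/
lemma mem_tangentSpace_stiefel {X V : Matrix (Fin n) (Fin k) ℝ} (hX : X ∈ stiefel n k) :
    V ∈ tangentSpace (stiefel n k) X ↔ Xᵀ * V + Vᵀ * X = 0 := by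
  constructor
  · intro h
    induction h using Submodule.span_induction with
    | mem v hv =>
      obtain ⟨γ, hγ, hM, rfl, rfl⟩ := hv
      have hd : HasDerivAt γ (deriv γ 0) 0 := ((hγ.differentiable (by simp)) 0).hasDerivAt
      have h1 := hasDerivAt_mul (hasDerivAt_transpose hd) hd
      have h2 : (fun s => (γ s)ᵀ * γ s) = fun _ => 1 := funext hM
      rw [h2] at h1
      exact h1.unique (hasDerivAt_const (0 : ℝ) (1 : Matrix (Fin k) (Fin k) ℝ))
    | zero => simp
    | add v w _ _ hv hw =>
      have : Xᵀ * (v + w) + (v + w)ᵀ * X = (Xᵀ * v + vᵀ * X) + (Xᵀ * w + wᵀ * X) := by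
        simp only [Matrix.mul_add, Matrix.transpose_add, Matrix.add_mul]; abel
      rw [this, hv, hw, add_zero]
    | smul c v _ hv =>
      have : Xᵀ * (c • v) + (c • v)ᵀ * X = c • (Xᵀ * v + vᵀ * X) := by simp
      rw [this, hv, smul_zero]
  · intro hV
    refine Submodule.subset_span ?_
    set ζ := liftElt X V hV with hζ
    refine ⟨fun s => Phi (expG (s • ζ)) X, ?_, fun s => Phi_mem hX _, by simp [Phi, expG], ?_⟩
    · have h := contDiff_mul (contDiff_mul (contDiff_exp ζ.1.1) contDiff_const (g := fun _ => X))
        (contDiff_exp (-ζ.1.2))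
      convert h using 2 with s
      exact Phi_expG_smul ζ s X
    · have h := hasDerivAt_mul (hasDerivAt_mul (hasDerivAt_exp ζ.1.1) (hasDerivAt_const (0 : ℝ) X))
        (hasDerivAt_exp (-ζ.1.2))
      have e : (fun s : ℝ => Phi (expG (s • ζ)) X) = fun s : ℝ =>
          NormedSpace.exp (s • ζ.1.1) * X * NormedSpace.exp (s • -ζ.1.2) :=
        funext fun s => Phi_expG_smul ζ s X
      rw [e, h.deriv]
      have := dOrbitOne_liftElt hX hV
      rw [dOrbitOne_apply] at this
      rw [← this]
      simp [hζ, sub_eq_add_neg, add_comm]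

lemma euclideanMetric_apply (V W : Matrix (Fin n) (Fin k) ℝ) :
    euclideanMetric n k V W = 2 * (Vᵀ * W).trace := rfl

lemma Phi_symm (q : OProd n k) (V W : Matrix (Fin n) (Fin k) ℝ) :
    (Vᵀ * Phi q W).trace = ((Phi q⁻¹ V)ᵀ * W).trace := by
  change (Vᵀ * (q.1.1 * W * q.2.1ᵀ)).trace = ((q.1.1ᵀ * V * q.2.1ᵀᵀ)ᵀ * W).trace
  simp only [Matrix.transpose_mul, Matrix.transpose_transpose, ← Matrix.mul_assoc]
  rw [Matrix.trace_mul_comm]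
  simp only [← Matrix.mul_assoc]

lemma Phi_mul (q r : OProd n k) (V : Matrix (Fin n) (Fin k) ℝ) :
    Phi (q * r) V = Phi q (Phi r V) := by
  simp [Phi, Matrix.mul_assoc]

lemma Phi_one (V : Matrix (Fin n) (Fin k) ℝ) : Phi 1 V = V := by
  simp [Phi]

lemma Phi_mem_tangentSpace {X V : Matrix (Fin n) (Fin k) ℝ} (hX : X ∈ stiefel n k) (q : OProd n k)
    (hV : V ∈ tangentSpace (stiefel n k) X) :
    Phi q V ∈ tangentSpace (stiefel n k) (Phi q X) := by
  rw [mem_tangentSpace_stiefel hX] at hV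
  rw [mem_tangentSpace_stiefel (Phi_mem hX q)]
  have h1 : q.1.1ᵀ * q.1.1 = 1 := (Matrix.mem_orthogonalGroup_iff' _ _).1 q.1.2
  have key : ∀ A B : Matrix (Fin n) (Fin k) ℝ,
      (Phi q A)ᵀ * Phi q B = q.2.1 * (Aᵀ * B) * q.2.1ᵀ := fun A B => by
    calc (q.1.1 * A * q.2.1ᵀ)ᵀ * (q.1.1 * B * q.2.1ᵀ)
        = q.2.1 * (Aᵀ * ((q.1.1ᵀ * q.1.1) * B)) * q.2.1ᵀ := by simp [Matrix.mul_assoc]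
      _ = _ := by rw [h1, Matrix.one_mul]
  rw [key, key, ← Matrix.add_mul, ← Matrix.mul_add, hV]
  simp

lemma Phi_mem_normalSpace {X V : Matrix (Fin n) (Fin k) ℝ} (hX : X ∈ stiefel n k) (q : OProd n k)
    (hV : V ∈ normalSpace (euclideanMetric n k) (stiefel n k) X) :
    Phi q V ∈ normalSpace (euclideanMetric n k) (stiefel n k) (Phi q X) := by
  rw [normalSpace, LinearMap.BilinForm.mem_orthogonal_iff] at hV ⊢
  intro W hW
  have h := Phi_mem_tangentSpace (Phi_mem hX q) q⁻¹ hW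
  rw [← Phi_mul, inv_mul_cancel, Phi_one] at h
  have := hV _ h
  rw [euclideanMetric_apply] at this ⊢
  rwa [Phi_symm]

lemma dOrbit_dLeft (X : Matrix (Fin n) (Fin k) ℝ) (q : OProd n k) (ζ : soProd n k) :
    dOrbit X q (dLeft q ζ) = Phi q (dOrbitOne X ζ) := by
  simp only [dOrbit, dLeft, Phi, dOrbitOne_apply, LinearMap.coe_mk, AddHom.coe_mk,
    Matrix.transpose_mul, (mem_soProd.1 ζ.2).2, Matrix.mul_add, Matrix.add_mul, Matrix.mul_assoc,
    Matrix.mul_neg, Matrix.neg_mul, sub_eq_add_neg]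

/-- For the Euclidean metric, the orthogonal projection onto every subspace exists. -/
lemma isCompl_orthogonal (W : Submodule ℝ (Matrix (Fin n) (Fin k) ℝ)) :
    IsCompl W ((euclideanMetric n k).orthogonal W) := by
  have hpos : ∀ A : Matrix (Fin n) (Fin k) ℝ, euclideanMetric n k A A = 0 → A = 0 := fun A hA => by
    rw [euclideanMetric_apply] at hA
    exact (Matrix.trace_conjTranspose_mul_self_eq_zero_iff (A := A)).1
      (by simpa [Matrix.conjTranspose_eq_transpose_of_trivial] using hA)
  have hsymm : ∀ A B, euclideanMetric n k A B = euclideanMetric n k B A := fun A B => by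
    rw [euclideanMetric_apply, euclideanMetric_apply, ← Matrix.trace_transpose (Aᵀ * B)]
    simp
  have hrefl : (euclideanMetric n k).IsRefl := fun A B h => by rw [hsymm, h]
  refine LinearMap.BilinForm.isCompl_orthogonal_of_restrict_nondegenerate hrefl
    (LinearMap.BilinForm.nondegenerate_restrict_of_disjoint_orthogonal _ hrefl ?_)
  rw [Submodule.disjoint_def]
  exact fun A hA hA' => hpos A (LinearMap.BilinForm.mem_orthogonal_iff.1 hA' A hA)

/-! ### The rolling along a geodesic -/

/-- The projection `pr_𝔭 : 𝔤 → 𝔭` along `𝔥`. -/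
def prP {X : Matrix (Fin n) (Fin k) ℝ} (hX : X ∈ stiefel n k) : soProd n k →ₗ[ℝ] pSub X :=
  (pSub X).projectionOnto (hSub X) (isCompl_pSub_hSub hX)

/-- The isomorphism `d_{(I_n, I_k)} (ι_X ∘ π)|_𝔭 : 𝔭 → T_X St(n,k)`. -/
def pEquiv {X : Matrix (Fin n) (Fin k) ℝ} (hX : X ∈ stiefel n k) :
    pSub X ≃ₗ[ℝ] tangentSpace (stiefel n k) X :=
  LinearEquiv.ofBijective
    ((dOrbitOne X ∘ₗ (pSub X).subtype).codRestrict (tangentSpace (stiefel n k) X) fun ζ =>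
      (mem_tangentSpace_stiefel hX).2 (dOrbitOne_skew hX ζ))
    ⟨(injective_iff_map_eq_zero _).2 fun ζ hζ => Subtype.ext <|
        Submodule.disjoint_def.1 (disjoint_hSub_pSub hX) _ ζ.2
          (LinearMap.mem_ker.2 (congrArg Subtype.val hζ)),
      fun V => ⟨⟨liftElt X V ((mem_tangentSpace_stiefel hX).1 V.2), liftElt_mem _⟩,
        Subtype.ext (dOrbitOne_liftElt hX ((mem_tangentSpace_stiefel hX).1 V.2))⟩⟩

/-- The tangent space `T_X St(n,k)` as a submanifold of `ℝ^{n×k}`, namely as a linear subspace. -/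
def tangentPlane (X : Matrix (Fin n) (Fin k) ℝ) : Set (Matrix (Fin n) (Fin k) ℝ) :=
  tangentSpace (stiefel n k) X

/-- The curve `β(t) = d_{(I_n, I_k)} (ι_X ∘ π) (t ξ)` in `T_X St(n,k)`. -/
def rollingCurve (X : Matrix (Fin n) (Fin k) ℝ) (ξ : soProd n k) (t : ℝ) :
    Matrix (Fin n) (Fin k) ℝ :=
  dOrbitOne X (t • ξ)

/-- The curve `(ι_X ∘ π) (exp (t ξ))` in `St(n,k)`. -/
def developmentCurve (X : Matrix (Fin n) (Fin k) ℝ) (ξ : soProd n k) (t : ℝ) :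
    Matrix (Fin n) (Fin k) ℝ :=
  Phi (expG (t • ξ)) X

/-- The canonical identification `T_{β(t)} (T_X St(n,k)) = T_X St(n,k)`. -/
lemma tangentSpace_tangentPlane {X : Matrix (Fin n) (Fin k) ℝ} (hX : X ∈ stiefel n k)
    (ξ : soProd n k) (t : ℝ) :
    tangentSpace (tangentPlane X) (rollingCurve X ξ t) = tangentSpace (stiefel n k) X :=
  tangentSpace_submodule _ ((mem_tangentSpace_stiefel hX).2 (dOrbitOne_skew hX _))

/-- The canonical identification `N_{β(t)} (T_X St(n,k)) = N_X St(n,k)`. -/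
lemma normalSpace_tangentPlane {X : Matrix (Fin n) (Fin k) ℝ} (hX : X ∈ stiefel n k)
    (ξ : soProd n k) (t : ℝ) :
    normalSpace (euclideanMetric n k) (tangentPlane X) (rollingCurve X ξ t) =
      normalSpace (euclideanMetric n k) (stiefel n k) X := by
  rw [normalSpace, normalSpace, tangentSpace_tangentPlane hX]

/-- The tangential part `B(t) : T_{β(t)} (T_X St(n,k)) → T_{β'(t)} St(n,k)` of the rolling, where
`β'` is the development curve and `q(t) = (e^{t ξ₁}, e^{t ξ₂})`: the composition
`d_{q(t)} (ι_X ∘ π) ∘ d L_{q(t)} ∘ exp (- (t / 2) (pr_𝔭 ∘ ad_ξ)) ∘ (d (ι_X ∘ π)|_𝔭)⁻¹`. -/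
def rollingB {X : Matrix (Fin n) (Fin k) ℝ} (hX : X ∈ stiefel n k) (ξ : soProd n k) (t : ℝ) :
    tangentSpace (tangentPlane X) (rollingCurve X ξ t) →ₗ[ℝ]
      tangentSpace (stiefel n k) (developmentCurve X ξ t) :=
  (dOrbit X (expG (t • ξ)) ∘ₗ dLeft (expG (t • ξ)) ∘ₗ (pSub X).subtype ∘ₗ
      endExp (W := pSub X) (-(1 / 2 * t) • (prP hX ∘ₗ adSo ξ ∘ₗ (pSub X).subtype)) ∘ₗ
      (pEquiv hX).symm.toLinearMap ∘ₗ
      (LinearEquiv.ofEq _ _ (tangentSpace_tangentPlane hX ξ t)).toLinearMap).codRestrict _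
    fun V => by
      simp only [LinearMap.comp_apply, dOrbit_dLeft]
      exact Phi_mem_tangentSpace hX _ ((mem_tangentSpace_stiefel hX).2 (dOrbitOne_skew hX _))

/-- The normal part `C(t) : N_{β(t)} (T_X St(n,k)) → N_{β'(t)} St(n,k)` of the rolling: the
composition `Φ_{(e^{t ξ₁}, e^{t ξ₂})} ∘ exp (- t (P_X^⊥ ∘ f_ξ))`, where `P_X^⊥` is the orthogonal
projection onto `N_X St(n,k)` and `P_X^⊥ ∘ f_ξ` is taken as an endomorphism of `N_X St(n,k)`. -/
def rollingC {X : Matrix (Fin n) (Fin k) ℝ} (hX : X ∈ stiefel n k) (ξ : soProd n k) (t : ℝ) :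
    normalSpace (euclideanMetric n k) (tangentPlane X) (rollingCurve X ξ t) →ₗ[ℝ]
      normalSpace (euclideanMetric n k) (stiefel n k) (developmentCurve X ξ t) :=
  (Phi (expG (t • ξ)) ∘ₗ (normalSpace (euclideanMetric n k) (stiefel n k) X).subtype ∘ₗ
      endExp (W := normalSpace (euclideanMetric n k) (stiefel n k) X) (-t • (orthProj (euclideanMetric n k)
          (normalSpace (euclideanMetric n k) (stiefel n k) X) ∘ₗ fMap ξ ∘ₗ
        (normalSpace (euclideanMetric n k) (stiefel n k) X).subtype)) ∘ₗ
      (LinearEquiv.ofEq _ _ (normalSpace_tangentPlane hX ξ t)).toLinearMap).codRestrict _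
    fun _ => Phi_mem_normalSpace hX _ (Subtype.prop _)

end

end StiefelRolling

/-!
Put `q(t) = (e^{t ξ₁}, e^{t ξ₂})`. The Leibniz rule reads
`d/dt (Φ_{q(t)} v) = Φ_{q(t)} (f_ξ v + v')`, and `Φ_{q(t)}` is an isometry carrying the tangent and
normal spaces at `X` to those at the development curve. For a subspace `W` of `ℝ^{n×k}` let
`S_W = (P_W ∘ f_ξ)|_W` (`compression`). It is skew because `f_ξ` is, so
`A_W(t) = Φ_{q(t)} ∘ e^{-t S_W}` is an isometry of `W` onto `Φ_{q(t)} W`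
(`isLinearIsometry_Phi_endExp`). For a curve `z` in `W`, the `Φ_{q(t)} W`-part of the derivative of
`A_W(t) z(t)` is `A_W(t) z'(t)`: the term `-S_W` coming from the exponential cancels the `W`-part of
`f_ξ`. Hence this part vanishes if and only if `z' = 0`, which is the no-twist condition
(`noTwist_Phi_endExp`).

For `W = N_X St(n,k)` the map `A_W(t)` is `C(t)` by definition. For `W = T_X St(n,k)` it is `B(t)`:
under `𝔭 ≅ T_X St(n,k)` the map `½ pr_𝔭 ∘ ad_ξ` becomes `S_W` (`pEquiv_half_prP_adSo`). Indeed, for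
`ζ ∈ 𝔭`, `V = f_ξ X` and `U = f_ζ X`, the difference `f_ξ U - f_ζ V` is the tangent vector
`f_{[ξ, ζ]} X`, while the sum `f_ξ U + f_ζ V = -X (Vᵀ U + Uᵀ V)` is normal
(`fMap_dOrbitOne_add_mem_normalSpace`). The case `ζ = ξ` of the latter says that `f_ξ (f_ξ X)` is
normal, so that the development curve is a geodesic, and `[ξ, ξ] = 0` gives the no-slip condition.
-/

namespace StiefelRolling

/-! ### Exponentials of endomorphisms -/

section EndExp

variable {W : Type*} [NormedAddCommGroup W] [NormedSpace ℝ W] [FiniteDimensional ℝ W]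

lemma endExp_zero : endExp (0 : W →ₗ[ℝ] W) = LinearMap.id := by
  ext v
  simp [endExp]

lemma endExp_neg_apply_endExp (A : W →ₗ[ℝ] W) (v : W) : endExp (-A) (endExp A v) = v := by
  have : CompleteSpace W := FiniteDimensional.complete ℝ W
  have h : NormedSpace.exp (-LinearMap.toContinuousLinearMap A) *
      NormedSpace.exp (LinearMap.toContinuousLinearMap A) = 1 := by
    let _ : NormedAlgebra ℚ (W →L[ℝ] W) := NormedAlgebra.restrictScalars ℚ ℝ _
    rw [← NormedSpace.exp_add_of_commute (Commute.refl _).neg_left, neg_add_cancel,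
      NormedSpace.exp_zero]
  have := congrArg (fun f : W →L[ℝ] W => f v) h
  simpa [endExp] using this

lemma endExp_apply_endExp_neg (A : W →ₗ[ℝ] W) (v : W) : endExp A (endExp (-A) v) = v := by
  simpa using endExp_neg_apply_endExp (-A) v

lemma endExp_smul_apply (A : W →ₗ[ℝ] W) (t : ℝ) (v : W) :
    endExp (t • A) v = (NormedSpace.exp (t • LinearMap.toContinuousLinearMap A) : W →L[ℝ] W) v := by
  simp [endExp]

/-- Product rule for `e^{sA} z(s)`. -/
lemma hasDerivWithinAt_endExp_smul (A : W →ₗ[ℝ] W) {z : ℝ → W} {z' : W} {I : Set ℝ} {t : ℝ}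
    (hz : HasDerivWithinAt z z' I t) :
    HasDerivWithinAt (fun s => endExp (s • A) (z s))
      (A (endExp (t • A) (z t)) + endExp (t • A) z') I t := by
  have : CompleteSpace W := FiniteDimensional.complete ℝ W
  have h := ((hasDerivAt_exp_smul_const' (LinearMap.toContinuousLinearMap A) t).hasDerivWithinAt
    (s := I)).clm_apply hz
  simpa [endExp_smul_apply] using h

lemma contDiffOn_endExp_smul (A : W →ₗ[ℝ] W) {z : ℝ → W} {I : Set ℝ} (hz : ContDiffOn ℝ ∞ z I) :
    ContDiffOn ℝ ∞ (fun s => endExp (s • A) (z s)) I := by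
  have : CompleteSpace W := FiniteDimensional.complete ℝ W
  have h : ContDiff ℝ ∞ (NormedSpace.exp : (W →L[ℝ] W) → (W →L[ℝ] W)) :=
    contDiff_iff_contDiffAt.2 fun x => (NormedSpace.exp_analytic (𝕂 := ℝ) x).contDiffAt
  have h' : ContDiff ℝ ∞ fun s : ℝ =>
      (NormedSpace.exp (s • LinearMap.toContinuousLinearMap A) : W →L[ℝ] W) :=
    h.comp (contDiff_id.smul contDiff_const)
  simpa [endExp_smul_apply] using h'.contDiffOn.clm_apply hz

lemma endExp_smul_apply_of_apply_eq_zero {A : W →ₗ[ℝ] W} {v : W} (hv : A v = 0) (t : ℝ) :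
    endExp (t • A) v = v := by
  have : CompleteSpace W := FiniteDimensional.complete ℝ W
  have hd : ∀ s : ℝ, HasDerivAt (fun r : ℝ => endExp (r • A) v) 0 s := fun s => by
    have h := (hasDerivAt_exp_smul_const (LinearMap.toContinuousLinearMap A) s).clm_apply
      (hasDerivAt_const s v)
    simpa [endExp_smul_apply, hv] using h
  have := is_const_of_deriv_eq_zero (fun s => (hd s).differentiableAt) (fun s => (hd s).deriv) t 0
  simpa [endExp_zero] using this

lemma endExp_conj {W' : Type*} [NormedAddCommGroup W'] [NormedSpace ℝ W'] [FiniteDimensional ℝ W']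
    (e : W ≃ₗ[ℝ] W') (A : W →ₗ[ℝ] W) (v : W') :
    e (endExp A (e.symm v)) = endExp (e.toLinearMap ∘ₗ A ∘ₗ e.symm.toLinearMap) v := by
  have : CompleteSpace W := FiniteDimensional.complete ℝ W
  have : CompleteSpace W' := FiniteDimensional.complete ℝ W'
  let _ : NormedAlgebra ℚ (W →L[ℝ] W) := NormedAlgebra.restrictScalars ℚ ℝ _
  let _ : NormedAlgebra ℚ (W' →L[ℝ] W') := NormedAlgebra.restrictScalars ℚ ℝ _
  have h := NormedSpace.map_exp e.toContinuousLinearEquiv.conjContinuousAlgEquiv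
    e.toContinuousLinearEquiv.conjContinuousAlgEquiv.continuous_toFun
    (LinearMap.toContinuousLinearMap A)
  have h' := congrArg (fun f : W' →L[ℝ] W' => f v) h
  have e1 : e.toContinuousLinearEquiv.conjContinuousAlgEquiv (LinearMap.toContinuousLinearMap A) =
      LinearMap.toContinuousLinearMap (e.toLinearMap ∘ₗ A ∘ₗ e.symm.toLinearMap) := by
    ext; simp
  rw [e1] at h'
  exact h'

end EndExp

variable {n k : ℕ}

/-! ### Orthogonal projections for the Euclidean metric -/

lemma euclideanMetric_comm (V W : Matrix (Fin n) (Fin k) ℝ) :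
    euclideanMetric n k V W = euclideanMetric n k W V := by
  rw [euclideanMetric_apply, euclideanMetric_apply, ← Matrix.trace_transpose (Vᵀ * W)]
  simp

lemma orthProj_eq_zero_iff (W : Submodule ℝ (Matrix (Fin n) (Fin k) ℝ))
    (V : Matrix (Fin n) (Fin k) ℝ) :
    orthProj (euclideanMetric n k) W V = 0 ↔ V ∈ (euclideanMetric n k).orthogonal W := by
  rw [orthProj, dif_pos (isCompl_orthogonal W)]
  exact Submodule.projectionOnto_apply_eq_zero_iff _

lemma orthProj_coe (W : Submodule ℝ (Matrix (Fin n) (Fin k) ℝ)) (v : W) :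
    orthProj (euclideanMetric n k) W v = v := by
  rw [orthProj, dif_pos (isCompl_orthogonal W)]
  exact Submodule.projectionOnto_apply_left _ v

lemma sub_orthProj_mem_orthogonal (W : Submodule ℝ (Matrix (Fin n) (Fin k) ℝ))
    (V : Matrix (Fin n) (Fin k) ℝ) :
    V - orthProj (euclideanMetric n k) W V ∈ (euclideanMetric n k).orthogonal W := by
  rw [← orthProj_eq_zero_iff, map_sub, orthProj_coe, sub_self]

lemma euclideanMetric_orthProj (W : Submodule ℝ (Matrix (Fin n) (Fin k) ℝ))
    (V : Matrix (Fin n) (Fin k) ℝ) (w : W) :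
    euclideanMetric n k w (orthProj (euclideanMetric n k) W V) = euclideanMetric n k w V := by
  have := LinearMap.BilinForm.mem_orthogonal_iff.1 (sub_orthProj_mem_orthogonal W V) w w.2
  rw [map_sub] at this
  exact (sub_eq_zero.1 this).symm

lemma orthogonal_orthogonal (W : Submodule ℝ (Matrix (Fin n) (Fin k) ℝ)) :
    (euclideanMetric n k).orthogonal ((euclideanMetric n k).orthogonal W) = W := by
  refine le_antisymm (fun V hV => ?_) fun V hV => ?_
  · have h1 := sub_orthProj_mem_orthogonal W V
    have h2 : V - orthProj (euclideanMetric n k) W V ∈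
        (euclideanMetric n k).orthogonal ((euclideanMetric n k).orthogonal W) :=
      Submodule.sub_mem _ hV
        (LinearMap.BilinForm.le_orthogonal_orthogonal
          (fun A B h => by rw [euclideanMetric_comm, h]) (Subtype.prop _))
    have := Submodule.disjoint_def.1 (isCompl_orthogonal
      ((euclideanMetric n k).orthogonal W)).disjoint _ h1 h2
    rw [sub_eq_zero.1 this]
    exact Subtype.prop _
  · exact LinearMap.BilinForm.le_orthogonal_orthogonal
      (fun A B h => by rw [euclideanMetric_comm, h]) hV

/-! ### Compressions of the infinitesimal action -/

lemma euclideanMetric_fMap (ξ : soProd n k) (V W : Matrix (Fin n) (Fin k) ℝ) :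
    euclideanMetric n k (fMap ξ V) W = -euclideanMetric n k V (fMap ξ W) := by
  obtain ⟨h1, h2⟩ := mem_soProd.1 ξ.2
  have e : (ξ.1.2 * (Vᵀ * W)).trace = (Vᵀ * (W * ξ.1.2)).trace := by
    rw [Matrix.trace_mul_comm, Matrix.mul_assoc]
  simp only [euclideanMetric_apply, fMap, LinearMap.coe_mk, AddHom.coe_mk, Matrix.transpose_sub,
    Matrix.transpose_mul, h1, h2, Matrix.sub_mul, Matrix.mul_sub, Matrix.trace_sub, Matrix.mul_neg,
    Matrix.neg_mul, Matrix.trace_neg, Matrix.mul_assoc, e]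
  ring

/-- The compression `(P_W ∘ f_ξ)|_W` of `f_ξ` to a subspace `W`, where `P_W` is the orthogonal
projection onto `W`. -/
noncomputable def compression (ξ : soProd n k) (W : Submodule ℝ (Matrix (Fin n) (Fin k) ℝ)) :
    W →ₗ[ℝ] W :=
  orthProj (euclideanMetric n k) W ∘ₗ fMap ξ ∘ₗ W.subtype

lemma compression_skew (ξ : soProd n k) (W : Submodule ℝ (Matrix (Fin n) (Fin k) ℝ)) (v w : W) :
    euclideanMetric n k (compression ξ W v) w = -euclideanMetric n k v (compression ξ W w) := by
  have h1 := euclideanMetric_orthProj W (fMap ξ v) w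
  have h2 := euclideanMetric_orthProj W (fMap ξ w) v
  rw [euclideanMetric_comm]
  simp only [compression, LinearMap.comp_apply, Submodule.subtype_apply]
  rw [h1, h2, euclideanMetric_comm, euclideanMetric_fMap]

/-- The exponential of a skew endomorphism is orthogonal: along `e^{sA} v`, `e^{sA} w` the scalar
product has derivative zero. -/
lemma euclideanMetric_endExp {W : Submodule ℝ (Matrix (Fin n) (Fin k) ℝ)} {A : W →ₗ[ℝ] W}
    (hA : ∀ v w : W, euclideanMetric n k (A v) w = -euclideanMetric n k v (A w)) (t : ℝ) (v w : W) :
    euclideanMetric n k (endExp (t • A) v) (endExp (t • A) w) = euclideanMetric n k v w := by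
  have hd : ∀ s : ℝ, ∀ u : W, HasDerivAt
      (fun r : ℝ => ((endExp (r • A) u : W) : Matrix (Fin n) (Fin k) ℝ))
      ((A (endExp (s • A) u) : W) : Matrix (Fin n) (Fin k) ℝ) s := fun s u => by
    have h := hasDerivWithinAt_univ.1
      (hasDerivWithinAt_endExp_smul A (hasDerivWithinAt_const s Set.univ u))
    rw [map_zero, add_zero] at h
    exact W.subtypeL.hasFDerivAt.comp_hasDerivAt s h
  have hg : ∀ s : ℝ, HasDerivAt
      (fun r : ℝ => euclideanMetric n k (endExp (r • A) v) (endExp (r • A) w)) 0 s := fun s => by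
    have h := ((euclideanMetric n k).toContinuousBilinearMap.isBoundedBilinearMap.hasFDerivAt
      (((endExp (s • A) v : W) : Matrix (Fin n) (Fin k) ℝ),
        ((endExp (s • A) w : W) : Matrix (Fin n) (Fin k) ℝ))
      ).comp_hasDerivAt s ((hd s v).prodMk (hd s w))
    refine h.congr_deriv ?_
    have := hA (endExp (s • A) v) (endExp (s • A) w)
    change euclideanMetric n k (endExp (s • A) v) (A (endExp (s • A) w)) +
      euclideanMetric n k (A (endExp (s • A) v)) (endExp (s • A) w) = 0
    rw [this, add_neg_cancel]
  have := is_const_of_deriv_eq_zero (fun s => (hg s).differentiableAt) (fun s => (hg s).deriv) t 0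
  simpa [endExp_zero] using this

/-! ### Fields moved by a one-parameter group -/

lemma hasDerivWithinAt_matrix_mul {l m p : ℕ} {f : ℝ → Matrix (Fin l) (Fin m) ℝ}
    {g : ℝ → Matrix (Fin m) (Fin p) ℝ} {f' : Matrix (Fin l) (Fin m) ℝ}
    {g' : Matrix (Fin m) (Fin p) ℝ} {I : Set ℝ} {t : ℝ} (hf : HasDerivWithinAt f f' I t)
    (hg : HasDerivWithinAt g g' I t) :
    HasDerivWithinAt (fun s => f s * g s) (f t * g' + f' * g t) I t := by
  have h := (LinearMap.mk₂ ℝ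
      (fun (A : Matrix (Fin l) (Fin m) ℝ) (B : Matrix (Fin m) (Fin p) ℝ) => A * B)
      Matrix.add_mul (fun c A B => Matrix.smul_mul c A B) Matrix.mul_add
      (fun c A B => Matrix.mul_smul A c B)).toContinuousBilinearMap.isBoundedBilinearMap.hasFDerivAt
        (f t, g t)
  exact h.comp_hasDerivWithinAt t (hf.prodMk hg)

lemma contDiffOn_matrix_mul {l m p : ℕ} {f : ℝ → Matrix (Fin l) (Fin m) ℝ}
    {g : ℝ → Matrix (Fin m) (Fin p) ℝ} {I : Set ℝ} (hf : ContDiffOn ℝ ∞ f I)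
    (hg : ContDiffOn ℝ ∞ g I) : ContDiffOn ℝ ∞ (fun s => f s * g s) I :=
  (LinearMap.mk₂ ℝ (fun (A : Matrix (Fin l) (Fin m) ℝ) (B : Matrix (Fin m) (Fin p) ℝ) => A * B)
      Matrix.add_mul (fun c A B => Matrix.smul_mul c A B) Matrix.mul_add
      (fun c A B => Matrix.mul_smul A c B)).toContinuousBilinearMap.isBoundedBilinearMap.contDiff
    |>.comp_contDiffOn (hf.prodMk hg)

lemma Phi_expG_neg_smul (ξ : soProd n k) (t : ℝ) (V : Matrix (Fin n) (Fin k) ℝ) :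
    Phi (expG (t • -ξ)) V = Phi (expG (t • ξ))⁻¹ V := by
  have h : expG (t • -ξ) = (expG (t • ξ))⁻¹ := by
    obtain ⟨h1, h2⟩ := mem_soProd.1 ξ.2
    refine Prod.ext (Subtype.ext ?_) (Subtype.ext ?_)
    · change NormedSpace.exp (t • -ξ.1.1) = (NormedSpace.exp (t • ξ.1.1))ᵀ
      rw [← Matrix.exp_transpose, Matrix.transpose_smul, h1]
    · change NormedSpace.exp (t • -ξ.1.2) = (NormedSpace.exp (t • ξ.1.2))ᵀ
      rw [← Matrix.exp_transpose, Matrix.transpose_smul, h2]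
  rw [h]

section

attribute [local instance] Matrix.frobeniusNormedRing Matrix.frobeniusNormedAlgebra

lemma hasDerivAt_matrix_exp_smul (A : Matrix (Fin n) (Fin n) ℝ) (t : ℝ) :
    HasDerivAt (fun s : ℝ => NormedSpace.exp (s • A)) (NormedSpace.exp (t • A) * A) t :=
  hasDerivAt_exp_smul_const A t

lemma hasDerivAt_matrix_exp_smul' (A : Matrix (Fin n) (Fin n) ℝ) (t : ℝ) :
    HasDerivAt (fun s : ℝ => NormedSpace.exp (s • A)) (A * NormedSpace.exp (t • A)) t :=
  hasDerivAt_exp_smul_const' A t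

end

/-- Product rule for `Φ_{q(s)}(v(s))` with `q(s) = (e^{s ξ₁}, e^{s ξ₂})`. -/
lemma hasDerivWithinAt_Phi (ξ : soProd n k) {v : ℝ → Matrix (Fin n) (Fin k) ℝ}
    {v' : Matrix (Fin n) (Fin k) ℝ} {I : Set ℝ} {t : ℝ} (hv : HasDerivWithinAt v v' I t) :
    HasDerivWithinAt (fun s => Phi (expG (s • ξ)) (v s))
      (Phi (expG (t • ξ)) (fMap ξ (v t) + v')) I t := by
  have h := hasDerivWithinAt_matrix_mul (hasDerivWithinAt_matrix_mul
    (hasDerivAt_matrix_exp_smul ξ.1.1 t).hasDerivWithinAt hv)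
    (hasDerivAt_matrix_exp_smul' (-ξ.1.2) t).hasDerivWithinAt
  simp only [Phi_expG_smul]
  refine h.congr_deriv ?_
  simp only [fMap, LinearMap.coe_mk, AddHom.coe_mk, Matrix.mul_add, Matrix.add_mul, Matrix.mul_sub,
    Matrix.sub_mul, Matrix.mul_neg, Matrix.neg_mul, Matrix.mul_assoc]
  abel

lemma contDiffOn_Phi (ξ : soProd n k) {v : ℝ → Matrix (Fin n) (Fin k) ℝ} {I : Set ℝ}
    (hv : ContDiffOn ℝ ∞ v I) : ContDiffOn ℝ ∞ (fun s => Phi (expG (s • ξ)) (v s)) I := by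
  simp only [Phi_expG_smul]
  exact contDiffOn_matrix_mul (contDiffOn_matrix_mul (contDiff_exp _).contDiffOn hv)
    (contDiff_exp _).contDiffOn

lemma contDiffOn_coe_iff {W : Submodule ℝ (Matrix (Fin n) (Fin k) ℝ)} {z : ℝ → W} {I : Set ℝ} :
    ContDiffOn ℝ ∞ (fun t => (z t : Matrix (Fin n) (Fin k) ℝ)) I ↔ ContDiffOn ℝ ∞ z I := by
  refine ⟨fun h => ?_, fun h => W.subtypeL.contDiff.comp_contDiffOn h⟩
  have := (LinearMap.toContinuousLinearMap
    (orthProj (euclideanMetric n k) W)).contDiff.comp_contDiffOn h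
  refine this.congr fun t _ => ?_
  exact (orthProj_coe W (z t)).symm

/-- The motion `Φ_{q(t)} ∘ e^{-t (P_W ∘ f_ξ)|_W}` is inverted by a motion of the same kind, so it
preserves and reflects smoothness of fields. -/
lemma contDiffOn_Phi_endExp_iff (ξ : soProd n k) {W : Submodule ℝ (Matrix (Fin n) (Fin k) ℝ)}
    {z : ℝ → W} {I : Set ℝ} :
    ContDiffOn ℝ ∞ (fun t => Phi (expG (t • ξ)) (endExp (-t • compression ξ W) (z t) : W)) I ↔
      ContDiffOn ℝ ∞ z I := by
  have e : ∀ t : ℝ, -t • compression ξ W = t • -compression ξ W := fun t =>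
    (neg_smul t (compression ξ W)).trans (smul_neg t (compression ξ W)).symm
  constructor
  · intro h
    have h1 := contDiffOn_Phi (-ξ) h
    simp only [Phi_expG_neg_smul] at h1
    simp only [← Phi_mul, inv_mul_cancel, Phi_one] at h1
    have h2 := contDiffOn_endExp_smul (compression ξ W) (contDiffOn_coe_iff.1 h1)
    refine h2.congr fun t _ => ?_
    have e' : -t • compression ξ W = -(t • compression ξ W) :=
      neg_smul t (compression ξ W)
    rw [e', endExp_apply_endExp_neg]
  · intro h
    refine contDiffOn_Phi ξ (contDiffOn_coe_iff.2 ?_)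
    simp only [e]
    exact contDiffOn_endExp_smul _ h

/-- If `Φ_{q(t)}` maps `W^⊥` onto `W'(t)^⊥`, then the `W'(t)`-part of the derivative of
`Φ_{q(t)} e^{-t (P_W ∘ f_ξ)|_W} z(t)` vanishes exactly when `z` has zero derivative: the compression
`(P_W ∘ f_ξ)|_W` cancels the `W`-part of the derivative of `Φ_{q(t)}`. -/
lemma orthProj_derivWithin_Phi_endExp_eq_zero_iff (ξ : soProd n k)
    {W W' : Submodule ℝ (Matrix (Fin n) (Fin k) ℝ)} {z : ℝ → W} {I : Set ℝ} {t : ℝ}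
    (hW' : ∀ V, Phi (expG (t • ξ)) V ∈ (euclideanMetric n k).orthogonal W' ↔
      V ∈ (euclideanMetric n k).orthogonal W)
    (hI : UniqueDiffWithinAt ℝ I t) (hz : DifferentiableWithinAt ℝ z I t) :
    orthProj (euclideanMetric n k) W' (derivWithin
        (fun t => Phi (expG (t • ξ)) (endExp (-t • compression ξ W) (z t) : W)) I t) = 0 ↔
      derivWithin z I t = 0 := by
  set S := compression ξ W with hS
  have e : ∀ t : ℝ, -t • S = t • -S := fun t => (neg_smul t S).trans (smul_neg t S).symm
  have h1 := hasDerivWithinAt_endExp_smul (-S) hz.hasDerivWithinAt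
  have h2 : HasDerivWithinAt (fun s => ((endExp (s • -S) (z s) : W) : Matrix (Fin n) (Fin k) ℝ))
      ((-S) (endExp (t • -S) (z t)) + endExp (t • -S) (derivWithin z I t) : W) I t :=
    W.subtypeL.hasFDerivAt.comp_hasDerivWithinAt t h1
  have h3 : derivWithin (fun s => Phi (expG (s • ξ)) (endExp (s • -S) (z s) : W)) I t = _ :=
    (hasDerivWithinAt_Phi ξ h2).derivWithin hI
  simp only [e]
  rw [h3, orthProj_eq_zero_iff, hW']
  set w := endExp (t • -S) (z t)
  set u := endExp (t • -S) (derivWithin z I t) with hu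
  have h4 : fMap ξ w - S w ∈ (euclideanMetric n k).orthogonal W :=
    sub_orthProj_mem_orthogonal W (fMap ξ w)
  have h5 : fMap ξ (w : Matrix (Fin n) (Fin k) ℝ) + (((-S) w + u : W) : Matrix (Fin n) (Fin k) ℝ) =
      (fMap ξ w - S w) + u := by
    simp only [LinearMap.neg_apply, Submodule.coe_add, Submodule.coe_neg]
    abel
  rw [h5, Submodule.add_mem_iff_right _ h4]
  constructor
  · intro h
    have h0 : u = 0 :=
      Subtype.ext (Submodule.disjoint_def.1 (isCompl_orthogonal W).disjoint _ u.2 h)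
    have := endExp_neg_apply_endExp (t • -S) (derivWithin z I t)
    rw [← hu, h0, map_zero] at this
    exact this.symm
  · intro h
    rw [hu, h]
    simp

lemma orthProj_derivWithin_coe_eq_zero_iff {W : Submodule ℝ (Matrix (Fin n) (Fin k) ℝ)}
    {z : ℝ → W} {I : Set ℝ} {t : ℝ} (hI : UniqueDiffWithinAt ℝ I t)
    (hz : DifferentiableWithinAt ℝ z I t) :
    orthProj (euclideanMetric n k) W (derivWithin (fun s => (z s : Matrix (Fin n) (Fin k) ℝ)) I t)
      = 0 ↔ derivWithin z I t = 0 := by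
  have h : HasDerivWithinAt (fun s => (z s : Matrix (Fin n) (Fin k) ℝ))
      (derivWithin z I t : W) I t :=
    W.subtypeL.hasFDerivAt.comp_hasDerivWithinAt t hz.hasDerivWithinAt
  have h' : derivWithin (fun s => (z s : Matrix (Fin n) (Fin k) ℝ)) I t = _ := h.derivWithin hI
  rw [h', orthProj_coe]

/-- No-twist condition for `Φ_{q(t)} ∘ e^{-t (P_W ∘ f_ξ)|_W}`. The subspaces `W₁ t` are all equal to
`W`, but not definitionally: they stand for the tangent or normal spaces of a linear subspace at
varying points. -/
lemma noTwist_Phi_endExp (ξ : soProd n k) {W : Submodule ℝ (Matrix (Fin n) (Fin k) ℝ)}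
    {W₁ W₂ : ℝ → Submodule ℝ (Matrix (Fin n) (Fin k) ℝ)} (hW₁ : ∀ t, W₁ t = W)
    (hW₂ : ∀ t V, Phi (expG (t • ξ)) V ∈ (euclideanMetric n k).orthogonal (W₂ t) ↔
      V ∈ (euclideanMetric n k).orthogonal W)
    (f : ∀ t, W₁ t →ₗ[ℝ] W₂ t)
    (hf : ∀ t v, (f t v : Matrix (Fin n) (Fin k) ℝ) =
      Phi (expG (t • ξ)) (endExp (-t • compression ξ W) (LinearEquiv.ofEq _ _ (hW₁ t) v) : W))
    {I : Set ℝ} (hI : UniqueDiffOn ℝ I) (Z : ∀ t, W₁ t) :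
    (ContDiffOn ℝ ∞ (fun t => (f t (Z t) : Matrix (Fin n) (Fin k) ℝ)) I ∧
      ∀ t ∈ I, orthProj (euclideanMetric n k) (W₂ t)
        (derivWithin (fun s => (f s (Z s) : Matrix (Fin n) (Fin k) ℝ)) I t) = 0) ↔
    (ContDiffOn ℝ ∞ (fun t => (Z t : Matrix (Fin n) (Fin k) ℝ)) I ∧
      ∀ t ∈ I, orthProj (euclideanMetric n k) (W₁ t)
        (derivWithin (fun s => (Z s : Matrix (Fin n) (Fin k) ℝ)) I t) = 0) := by
  obtain rfl : W₁ = fun _ => W := funext hW₁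
  simp only [hf]
  have hid : ∀ t, LinearEquiv.ofEq W W (hW₁ t) (Z t) = Z t := fun t => rfl
  simp only [hid]
  rw [contDiffOn_Phi_endExp_iff, contDiffOn_coe_iff]
  refine and_congr_right fun hz => forall₂_congr fun t ht => ?_
  have hd : DifferentiableWithinAt ℝ Z I t := hz.differentiableOn (by simp) t ht
  rw [orthProj_derivWithin_Phi_endExp_eq_zero_iff ξ (hW₂ t) (hI t ht) hd,
    orthProj_derivWithin_coe_eq_zero_iff (hI t ht) hd]

lemma euclideanMetric_Phi (q : OProd n k) (V W : Matrix (Fin n) (Fin k) ℝ) :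
    euclideanMetric n k (Phi q V) (Phi q W) = euclideanMetric n k V W := by
  rw [euclideanMetric_apply, euclideanMetric_apply, Phi_symm, ← Phi_mul, inv_mul_cancel, Phi_one]

lemma isLinearIsometry_Phi_endExp (ξ : soProd n k) (t : ℝ)
    {W W₁ W₂ : Submodule ℝ (Matrix (Fin n) (Fin k) ℝ)} (hW₁ : W₁ = W)
    (hW₂ : ∀ V, Phi (expG (t • ξ)) V ∈ W₂ ↔ V ∈ W) (f : W₁ →ₗ[ℝ] W₂)
    (hf : ∀ v, (f v : Matrix (Fin n) (Fin k) ℝ) =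
      Phi (expG (t • ξ)) (endExp (-t • compression ξ W) (LinearEquiv.ofEq _ _ hW₁ v) : W)) :
    IsLinearIsometry (euclideanMetric n k) f := by
  subst hW₁
  have hf' : ∀ v, (f v : Matrix (Fin n) (Fin k) ℝ) =
      Phi (expG (t • ξ)) (endExp (-t • compression ξ W₁) v) := hf
  refine ⟨⟨fun v w h => ?_, fun u => ?_⟩, fun v w => ?_⟩
  · have h1 := congrArg (Phi (expG (t • ξ))⁻¹) ((hf' v).symm.trans
      ((congrArg Subtype.val h).trans (hf' w)))
    simp only [← Phi_mul, inv_mul_cancel, Phi_one] at h1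
    rw [← endExp_neg_apply_endExp (-t • compression ξ W₁) v, Subtype.ext h1,
      endExp_neg_apply_endExp]
  · have h1 : Phi (expG (t • ξ)) (Phi (expG (t • ξ))⁻¹ u) = u := by
      rw [← Phi_mul, mul_inv_cancel, Phi_one]
    refine ⟨endExp (-(-t • compression ξ W₁)) ⟨Phi (expG (t • ξ))⁻¹ u, ?_⟩, Subtype.ext ?_⟩
    · rw [← hW₂, h1]
      exact u.2
    · rw [hf', endExp_apply_endExp_neg, h1]
  · rw [hf', hf', euclideanMetric_Phi, euclideanMetric_endExp (compression_skew ξ W₁)]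

/-! ### The second fundamental form of the Stiefel manifold along `𝔭` -/

lemma eq_liftElt {X : Matrix (Fin n) (Fin k) ℝ} (hX : X ∈ stiefel n k) {ζ : soProd n k}
    (hζ : ζ ∈ pSub X) : ζ = liftElt X (dOrbitOne X ζ) (dOrbitOne_skew hX ζ) := by
  refine sub_eq_zero.1 (Submodule.disjoint_def.1 (disjoint_hSub_pSub hX) _
    (Submodule.sub_mem _ hζ (liftElt_mem _)) ?_)
  rw [hSub, LinearMap.mem_ker, map_sub, dOrbitOne_liftElt hX, sub_self]

lemma dOrbitOne_eq_fMap (X : Matrix (Fin n) (Fin k) ℝ) (ζ : soProd n k) :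
    dOrbitOne X ζ = fMap ζ X :=
  dOrbitOne_apply X ζ

lemma dOrbitOne_mem_tangentSpace {X : Matrix (Fin n) (Fin k) ℝ} (hX : X ∈ stiefel n k)
    (ζ : soProd n k) : dOrbitOne X ζ ∈ tangentSpace (stiefel n k) X :=
  (mem_tangentSpace_stiefel hX).2 (dOrbitOne_skew hX ζ)

lemma mul_mem_normalSpace {X : Matrix (Fin n) (Fin k) ℝ} (hX : X ∈ stiefel n k)
    {S : Matrix (Fin k) (Fin k) ℝ} (hS : Sᵀ = S) :
    X * S ∈ normalSpace (euclideanMetric n k) (stiefel n k) X := by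
  rw [normalSpace, LinearMap.BilinForm.mem_orthogonal_iff]
  intro U hU
  have h := eq_neg_of_add_eq_zero_right ((mem_tangentSpace_stiefel hX).1 hU)
  have h1 : (Uᵀ * (X * S)).trace = -(Uᵀ * (X * S)).trace := by
    calc (Uᵀ * (X * S)).trace = ((Uᵀ * (X * S))ᵀ).trace := (Matrix.trace_transpose _).symm
      _ = (S * (Xᵀ * U)).trace := by simp [hS, Matrix.mul_assoc]
      _ = -((Uᵀ * X) * S).trace := by rw [h, Matrix.neg_mul, Matrix.trace_neg, neg_neg,
          Matrix.trace_mul_comm]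
      _ = _ := by rw [Matrix.mul_assoc]
  rw [euclideanMetric_apply]
  linarith

/-- For `ξ`, `ζ` in `𝔭` with `V = ξ₁ X - X ξ₂` and `W = ζ₁ X - X ζ₂`, the symmetrised second
derivative `f_ξ W + f_ζ V` of the action equals `-X (Vᵀ W + Wᵀ V)`, hence is normal. -/
lemma fMap_dOrbitOne_add_mem_normalSpace {X : Matrix (Fin n) (Fin k) ℝ} (hX : X ∈ stiefel n k)
    {ξ ζ : soProd n k} (hξ : ξ ∈ pSub X) (hζ : ζ ∈ pSub X) :
    fMap ξ (dOrbitOne X ζ) + fMap ζ (dOrbitOne X ξ) ∈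
      normalSpace (euclideanMetric n k) (stiefel n k) X := by
  set V := dOrbitOne X ξ with hV
  set W := dOrbitOne X ζ with hW
  have e : fMap ξ W + fMap ζ V = X * (-(Vᵀ * W + Wᵀ * V)) := by
    rw [eq_liftElt hX hξ, eq_liftElt hX hζ]
    simp only [fMap, liftElt, LinearMap.coe_mk, AddHom.coe_mk, ← hV, ← hW, Matrix.sub_mul,
      Matrix.mul_assoc, Matrix.mul_neg, Matrix.mul_add]
    abel
  rw [e]
  exact mul_mem_normalSpace hX (by simp [add_comm])

lemma dOrbitOne_adSo (X : Matrix (Fin n) (Fin k) ℝ) (ξ ζ : soProd n k) :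
    dOrbitOne X (adSo ξ ζ) = fMap ξ (dOrbitOne X ζ) - fMap ζ (dOrbitOne X ξ) := by
  simp only [dOrbitOne_apply, fMap, adSo, LinearMap.coe_mk, AddHom.coe_mk, Ring.lie_def,
    Matrix.sub_mul, Matrix.mul_sub, Matrix.mul_assoc]
  abel

/-- The projection `pr_𝔭` runs along the kernel `𝔥` of `d (ι_X ∘ π)`. -/
lemma dOrbitOne_prP {X : Matrix (Fin n) (Fin k) ℝ} (hX : X ∈ stiefel n k) (ζ : soProd n k) :
    dOrbitOne X (prP hX ζ) = dOrbitOne X ζ := by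
  have h : ζ - prP hX ζ ∈ hSub X := by
    rw [← Submodule.projectionOnto_apply_eq_zero_iff (isCompl_pSub_hSub hX), map_sub]
    exact sub_eq_zero.2 (Submodule.projectionOnto_apply_left _ _).symm
  rw [hSub, LinearMap.mem_ker, map_sub] at h
  exact (sub_eq_zero.1 h).symm

/-- Under `𝔭 ≅ T_X St(n,k)`, the map `½ pr_𝔭 ∘ ad_ξ` is the compression of `f_ξ` to the tangent
space: with `V = f_ξ X` and `U = f_ζ X`, the vector `f_ξ U` is half the sum of the normal vector
`f_ξ U + f_ζ V` and the tangent vector `f_ξ U - f_ζ V = d (ι_X ∘ π) [ξ, ζ]`. -/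
lemma pEquiv_half_prP_adSo {X : Matrix (Fin n) (Fin k) ℝ} (hX : X ∈ stiefel n k)
    {ξ : soProd n k} (hξ : ξ ∈ pSub X) (ζ : pSub X) :
    (1 / 2 : ℝ) • pEquiv hX (prP hX (adSo ξ ζ)) =
      compression ξ (tangentSpace (stiefel n k) X) (pEquiv hX ζ) := by
  have h1 : ((pEquiv hX (prP hX (adSo ξ ζ)) : tangentSpace (stiefel n k) X) :
      Matrix (Fin n) (Fin k) ℝ) =
      fMap ξ (dOrbitOne X ζ) - fMap ζ (dOrbitOne X ξ) :=
    (dOrbitOne_prP hX _).trans (dOrbitOne_adSo X ξ ζ)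
  have h2 := (orthProj_eq_zero_iff _ _).2 (fMap_dOrbitOne_add_mem_normalSpace hX hξ ζ.2)
  have h3 := orthProj_coe _ (pEquiv hX (prP hX (adSo ξ ζ)))
  rw [h1] at h3
  rw [← h3]
  change _ = orthProj (euclideanMetric n k) _ (fMap ξ (dOrbitOne X ζ))
  have h4 : fMap ξ (dOrbitOne X ζ) =
      (1 / 2 : ℝ) • (fMap ξ (dOrbitOne X ζ) + fMap ζ (dOrbitOne X ξ)) +
        (1 / 2 : ℝ) • (fMap ξ (dOrbitOne X ζ) - fMap ζ (dOrbitOne X ξ)) := by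
    module
  conv_rhs => rw [h4, map_add, map_smul, map_smul, h2, smul_zero, zero_add]

/-! ### The rolling along a geodesic -/

lemma rollingB_apply {X : Matrix (Fin n) (Fin k) ℝ} (hX : X ∈ stiefel n k) {ξ : soProd n k}
    (hξ : ξ ∈ pSub X) (t : ℝ) (v : tangentSpace (tangentPlane X) (rollingCurve X ξ t)) :
    (rollingB hX ξ t v : Matrix (Fin n) (Fin k) ℝ) =
      Phi (expG (t • ξ)) (endExp (-t • compression ξ (tangentSpace (stiefel n k) X))
        (LinearEquiv.ofEq _ _ (tangentSpace_tangentPlane hX ξ t) v)) := by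
  have e : (pEquiv hX).toLinearMap ∘ₗ
      (-(1 / 2 * t) • (prP hX ∘ₗ adSo ξ ∘ₗ (pSub X).subtype)) ∘ₗ (pEquiv hX).symm.toLinearMap =
      -t • compression ξ (tangentSpace (stiefel n k) X) := by
    refine LinearMap.ext fun w => ?_
    have h := pEquiv_half_prP_adSo hX hξ ((pEquiv hX).symm w)
    rw [LinearEquiv.apply_symm_apply] at h
    simp only [LinearMap.comp_apply, LinearMap.smul_apply, LinearEquiv.coe_coe, map_smul,
      Submodule.subtype_apply, ← h]
    module
  have h := endExp_conj (W := pSub X) (W' := tangentSpace (stiefel n k) X) (pEquiv hX)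
    (-(1 / 2 * t) • (prP hX ∘ₗ adSo ξ ∘ₗ (pSub X).subtype))
    (LinearEquiv.ofEq _ _ (tangentSpace_tangentPlane hX ξ t) v)
  rw [← e, ← h]
  exact dOrbit_dLeft _ _ _

lemma Phi_mem_tangentSpace_iff {X : Matrix (Fin n) (Fin k) ℝ} (hX : X ∈ stiefel n k)
    (q : OProd n k) (V : Matrix (Fin n) (Fin k) ℝ) :
    Phi q V ∈ tangentSpace (stiefel n k) (Phi q X) ↔ V ∈ tangentSpace (stiefel n k) X := by
  refine ⟨fun h => ?_, Phi_mem_tangentSpace hX q⟩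
  have := Phi_mem_tangentSpace (Phi_mem hX q) q⁻¹ h
  simpa only [← Phi_mul, inv_mul_cancel, Phi_one] using this

lemma Phi_mem_normalSpace_iff {X : Matrix (Fin n) (Fin k) ℝ} (hX : X ∈ stiefel n k)
    (q : OProd n k) (V : Matrix (Fin n) (Fin k) ℝ) :
    Phi q V ∈ normalSpace (euclideanMetric n k) (stiefel n k) (Phi q X) ↔
      V ∈ normalSpace (euclideanMetric n k) (stiefel n k) X := by
  refine ⟨fun h => ?_, Phi_mem_normalSpace hX q⟩
  have := Phi_mem_normalSpace (Phi_mem hX q) q⁻¹ h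
  simpa only [← Phi_mul, inv_mul_cancel, Phi_one] using this

lemma rollingCurve_eq_smul (X : Matrix (Fin n) (Fin k) ℝ) (ξ : soProd n k) (t : ℝ) :
    rollingCurve X ξ t = t • dOrbitOne X ξ :=
  map_smul _ _ _

lemma hasDerivAt_rollingCurve (X : Matrix (Fin n) (Fin k) ℝ) (ξ : soProd n k) (t : ℝ) :
    HasDerivAt (rollingCurve X ξ) (dOrbitOne X ξ) t := by
  have h := (hasDerivAt_id t).smul_const (dOrbitOne X ξ)
  rw [one_smul] at h
  exact h.congr_of_eventuallyEq (Filter.Eventually.of_forall fun s => rollingCurve_eq_smul X ξ s)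

lemma hasDerivWithinAt_developmentCurve (X : Matrix (Fin n) (Fin k) ℝ) (ξ : soProd n k)
    (I : Set ℝ) (t : ℝ) :
    HasDerivWithinAt (developmentCurve X ξ) (Phi (expG (t • ξ)) (dOrbitOne X ξ)) I t := by
  have h := hasDerivWithinAt_Phi ξ (hasDerivWithinAt_const t I X)
  rw [add_zero, ← dOrbitOne_eq_fMap] at h
  exact h

lemma isCurve_developmentCurve {X : Matrix (Fin n) (Fin k) ℝ} (hX : X ∈ stiefel n k)
    (ξ : soProd n k) (I : Set ℝ) : IsCurve (stiefel n k) I (developmentCurve X ξ) :=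
  ⟨contDiffOn_Phi ξ contDiffOn_const, fun _ _ => Phi_mem hX _⟩

lemma isCurve_rollingCurve {X : Matrix (Fin n) (Fin k) ℝ} (hX : X ∈ stiefel n k)
    (ξ : soProd n k) (I : Set ℝ) : IsCurve (tangentPlane X) I (rollingCurve X ξ) := by
  refine ⟨?_, fun t _ => dOrbitOne_mem_tangentSpace hX _⟩
  have : rollingCurve X ξ = fun t => t • dOrbitOne X ξ := funext (rollingCurve_eq_smul X ξ)
  rw [this]
  exact (contDiff_id.smul contDiff_const).contDiffOn

lemma isGeodesic_developmentCurve {X : Matrix (Fin n) (Fin k) ℝ} (hX : X ∈ stiefel n k)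
    {ξ : soProd n k} (hξ : ξ ∈ pSub X) {I : Set ℝ} (hI : UniqueDiffOn ℝ I) :
    IsGeodesic (euclideanMetric n k) (stiefel n k) I (developmentCurve X ξ) := by
  refine ⟨isCurve_developmentCurve hX ξ I, fun t ht => (orthProj_eq_zero_iff _ _).2 ?_⟩
  have h1 : ∀ s ∈ I, derivWithin (developmentCurve X ξ) I s =
      Phi (expG (s • ξ)) (dOrbitOne X ξ) := fun s hs =>
    (hasDerivWithinAt_developmentCurve X ξ I s).derivWithin (hI s hs)
  have h2 := hasDerivWithinAt_Phi ξ (hasDerivWithinAt_const t I (dOrbitOne X ξ))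
  rw [add_zero] at h2
  have h2' := (h2.congr h1 (h1 t ht)).derivWithin (hI t ht)
  refine (congrArg (fun V => V ∈ normalSpace (euclideanMetric n k) (stiefel n k)
    (Phi (expG (t • ξ)) X)) h2').mpr ?_
  refine (Phi_mem_normalSpace_iff hX _ _).2 ?_
  have h3 := fMap_dOrbitOne_add_mem_normalSpace hX hξ hξ
  have h4 := Submodule.smul_mem _ (1 / 2 : ℝ) h3
  convert h4 using 1
  module

/-- The velocity of the rolling curve is fixed by the exponential in `B(t)`, since
`[ξ, ξ] = 0`. -/
lemma rollingB_dOrbitOne {X : Matrix (Fin n) (Fin k) ℝ} (hX : X ∈ stiefel n k) {ξ : soProd n k}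
    (hξ : ξ ∈ pSub X) (t : ℝ) (v : tangentSpace (tangentPlane X) (rollingCurve X ξ t))
    (hv : (v : Matrix (Fin n) (Fin k) ℝ) = dOrbitOne X ξ) :
    (rollingB hX ξ t v : Matrix (Fin n) (Fin k) ℝ) = Phi (expG (t • ξ)) (dOrbitOne X ξ) := by
  have e : (LinearEquiv.ofEq _ _ (tangentSpace_tangentPlane hX ξ t) v) = pEquiv hX ⟨ξ, hξ⟩ :=
    Subtype.ext hv
  set S := compression ξ (tangentSpace (stiefel n k) X)
  have h0 : S (pEquiv hX ⟨ξ, hξ⟩) = 0 := by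
    rw [← pEquiv_half_prP_adSo hX hξ]
    have : adSo ξ ξ = 0 := by
      ext : 2 <;> simp [adSo]
    simp [this]
  rw [rollingB_apply hX hξ, e, endExp_smul_apply_of_apply_eq_zero h0]
  rfl

/-- The quadruple `(β, β', B, C)` is an extrinsic rolling. Both `B` and `C` are of the form
`Φ_{q(t)} ∘ e^{-t (P_W ∘ f_ξ)|_W}`, with `W` the tangent and the normal space at `X`. -/
lemma isExtrinsicRolling_rollingB_rollingC {X : Matrix (Fin n) (Fin k) ℝ} (hX : X ∈ stiefel n k)
    {ξ : soProd n k} (hξ : ξ ∈ pSub X) {I : Set ℝ} (hI : UniqueDiffOn ℝ I) :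
    IsExtrinsicRolling (euclideanMetric n k) (tangentPlane X) (stiefel n k) I
      (rollingCurve X ξ) (developmentCurve X ξ) (rollingB hX ξ) (rollingC hX ξ) := by
  refine
    { rolling_curve := isCurve_rollingCurve hX ξ I
      development_curve := isCurve_developmentCurve hX ξ I
      isometry_tangent := fun t _ => isLinearIsometry_Phi_endExp ξ t
        (tangentSpace_tangentPlane hX ξ t) (Phi_mem_tangentSpace_iff hX _) _
        (rollingB_apply hX hξ t)
      isometry_normal := fun t _ => isLinearIsometry_Phi_endExp ξ t
        (normalSpace_tangentPlane hX ξ t) (Phi_mem_normalSpace_iff hX _) _ fun _ => rfl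
      no_slip := fun t ht => ?_
      no_twist_tangent := fun Z => noTwist_Phi_endExp ξ (tangentSpace_tangentPlane hX ξ)
        (fun t => Phi_mem_normalSpace_iff hX _) _ (rollingB_apply hX hξ) hI Z
      no_twist_normal := fun Z => noTwist_Phi_endExp ξ (normalSpace_tangentPlane hX ξ)
        (fun t V => ?_) _ (fun _ _ => rfl) hI Z }
  · have hv : dOrbitOne X ξ ∈ tangentSpace (tangentPlane X) (rollingCurve X ξ t) := by
      rw [tangentSpace_tangentPlane hX]
      exact dOrbitOne_mem_tangentSpace hX ξ
    refine ⟨⟨_, hv⟩, ((hasDerivAt_rollingCurve X ξ t).hasDerivWithinAt.derivWithin (hI t ht)).symm,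
      ?_⟩
    rw [rollingB_dOrbitOne hX hξ t ⟨_, hv⟩ rfl]
    exact (hasDerivWithinAt_developmentCurve X ξ I t).derivWithin (hI t ht)
  · simp only [normalSpace, orthogonal_orthogonal]
    exact Phi_mem_tangentSpace_iff hX _ V

end StiefelRolling

theorem mainTheorem7 (n k : ℕ) (_hk : 1 ≤ k) (_hkn : k ≤ n)
    (X : Matrix (Fin n) (Fin k) ℝ) (hX : X ∈ StiefelRolling.stiefel n k)
    (ξ : StiefelRolling.soProd n k) (_hξ : ξ ∈ StiefelRolling.pSub X)
    (I : Set ℝ) (_hI : I.OrdConnected) (_hI' : I.Nontrivial) :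
    (∀ t : ℝ, StiefelRolling.rollingCurve X ξ t = t • (ξ.1.1 * X - X * ξ.1.2)) ∧
    (∀ t : ℝ, StiefelRolling.developmentCurve X ξ t =
      NormedSpace.exp (t • ξ.1.1) * X * NormedSpace.exp (-(t • ξ.1.2))) ∧
    StiefelRolling.IsExtrinsicRolling (StiefelRolling.euclideanMetric n k)
      (StiefelRolling.tangentPlane X) (StiefelRolling.stiefel n k) I
      (StiefelRolling.rollingCurve X ξ) (StiefelRolling.developmentCurve X ξ)
      (StiefelRolling.rollingB hX ξ) (StiefelRolling.rollingC hX ξ) ∧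
    StiefelRolling.IsGeodesic (StiefelRolling.euclideanMetric n k) (StiefelRolling.stiefel n k) I
      (StiefelRolling.developmentCurve X ξ) := by
  have hI : UniqueDiffOn ℝ I :=
    uniqueDiffOn_convex _hI.convex (_hI.convex.nontrivial_iff_nonempty_interior.1 _hI')
  refine ⟨fun t => ?_, fun t => ?_,
    StiefelRolling.isExtrinsicRolling_rollingB_rollingC hX _hξ hI,
    StiefelRolling.isGeodesic_developmentCurve hX _hξ hI⟩
  · rw [StiefelRolling.rollingCurve_eq_smul, StiefelRolling.dOrbitOne_apply]
  · rw [← smul_neg]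
    exact StiefelRolling.Phi_expG_smul ξ t X
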